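/- Let $K$ be a field, $R=K[x_1,\dots,x_n]$ with the standard grading, $d$ a positive integer, and let $I\subseteq R$ be a monomial ideal generated in degree $d$ (that is, generated by monomials of degree $d$; $I=0$ is allowed). Let $\mathbf u$ be a monomial that is strongly linear over $I$, i.e. $\deg \mathbf u=d-1$ and the colon ideal $I:\mathbf u=\{f\in R: f\mathbf u\in I\}$ is generated by a (possibly empty) set of variables. For a monomial ideal $J$ of $R$ let $\beta_{s,t}(J)$ be its graded Betti numbers, i.e. the number of basis elements of total degree $t$ in homological degree $s$ of a minimal multigraded free resolution of $J$ over $R$; let $\operatorname{reg}(J)=\max\{t-s:\beta_{s,t}(J)\neq 0\}$ for $J\ne 0$; and say that $J$ has a linear resolution if there is an integer $c$ with $\beta_{s,t}(J)=0$ whenever $t-s\neq c$. Let $A\subseteq\{1,\dots,n\}$ be any subset and put $I'=I+\mathbf u\,(x_i: i\in A)$. Then: 1. $\beta_{s,t}(I')=\beta_{s,t}(I)$ for all $s\geq 0$ and all $t\in\mathbb Z$ with $t-s\neq d$; 2. if $I\neq 0$, then $\operatorname{reg}(I')=\operatorname{reg}(I)$ (both maxima exist); 3. $I$ has a linear resolution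 if and only if $I'$ has a linear resolution. -/

import Mathlib

namespace MonomialBetti

/-- The monomial ideal spanned by the monomials with exponent vectors in `S`. -/
noncomputable def monomialIdeal (K : Type*) [Field K] {n : ℕ} (S : Set (Fin n →₀ ℕ)) :
    Ideal (MvPolynomial (Fin n) K) :=
  Ideal.span ((fun a => MvPolynomial.monomial a (1 : K)) '' S)

/-- `I` is a monomial ideal generated in degree `d`: it is generated by monomials
of total degree `d`. -/
def IsMonomialGeneratedInDegree {K : Type*} [Field K] {n : ℕ}
    (I : Ideal (MvPolynomial (Fin n) K)) (d : ℕ) : Prop :=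
  ∃ S : Set (Fin n →₀ ℕ), (∀ a ∈ S, a.degree = d) ∧ I = monomialIdeal K S

/-- The ideal `(x_i : i ∈ A)`. -/
noncomputable def variableIdeal (K : Type*) [Field K] {n : ℕ} (A : Set (Fin n)) :
    Ideal (MvPolynomial (Fin n) K) :=
  Ideal.span ((fun i => MvPolynomial.X i) '' A)

/-- The monomial `x^u` is strongly linear over `I`, where `I` is a monomial ideal generated
in degree `d`: one has `deg x^u = d - 1`, and the colon ideal `I : x^u` is generated by
variables. -/
structure IsStronglyLinear {K : Type*} [Field K] {n : ℕ}
    (I : Ideal (MvPolynomial (Fin n) K)) (d : ℕ) (u : Fin n →₀ ℕ) : Prop where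
  generated : IsMonomialGeneratedInDegree I d
  degree_add_one : u.degree + 1 = d
  colon_eq : ∃ B : Set (Fin n),
    Submodule.colon I {MvPolynomial.monomial u (1 : K)} = variableIdeal K B

/-- `f` is multihomogeneous of multidegree `a ∈ ℤⁿ`, i.e. `f ∈ K · x^a`
(and `f = 0` if `a` has a negative entry). -/
def IsMultihomogeneous {K : Type*} [Field K] {n : ℕ}
    (f : MvPolynomial (Fin n) K) (a : Fin n → ℤ) : Prop :=
  ∀ m ∈ f.support, ∀ v, (m v : ℤ) = a v

/-- A minimal multigraded free resolution `⋯ → F₁ → F₀ → I → 0` of an ideal `I` of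
`R = K[x₁, …, xₙ]`. Here `F_i = R ^ rank i`, the `k`-th standard basis vector of `F_i` having
multidegree `mdeg i k`. -/
structure MinimalResolution {K : Type*} [Field K] {n : ℕ}
    (I : Ideal (MvPolynomial (Fin n) K)) where
  /-- the rank of `F_i` -/
  rank : ℕ → ℕ
  /-- the multidegrees of the standard basis vectors of `F_i` -/
  mdeg : (i : ℕ) → Fin (rank i) → (Fin n → ℤ)
  /-- the augmentation `F₀ → I ⊆ R` -/
  aug : (Fin (rank 0) → MvPolynomial (Fin n) K) →ₗ[MvPolynomial (Fin n) K]
    MvPolynomial (Fin n) K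
  /-- the differential `F_{i+1} → F_i` -/
  diff : (i : ℕ) → (Fin (rank (i + 1)) → MvPolynomial (Fin n) K) →ₗ[MvPolynomial (Fin n) K]
    (Fin (rank i) → MvPolynomial (Fin n) K)
  /-- the augmentation preserves multidegrees -/
  aug_homogeneous : ∀ k, IsMultihomogeneous (aug (Pi.single k 1)) (mdeg 0 k)
  /-- the differentials preserve multidegrees -/
  diff_homogeneous : ∀ i k l,
    IsMultihomogeneous (diff i (Pi.single k 1) l) (mdeg (i + 1) k - mdeg i l)
  /-- the augmentation maps onto `I` -/
  range_aug : LinearMap.range aug = I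
  exact_zero : Function.Exact (diff 0) aug
  exact_succ : ∀ i, Function.Exact (diff (i + 1)) (diff i)
  /-- minimality: the entries of the matrices of the differentials lie in `(x₁, …, xₙ)` -/
  minimal : ∀ i k l, MvPolynomial.constantCoeff (diff i (Pi.single k 1) l) = 0

/-- The number of basis vectors of `F_i` whose multidegree has coordinate sum `j`. -/
noncomputable def MinimalResolution.gradedRank {K : Type*} [Field K] {n : ℕ}
    {I : Ideal (MvPolynomial (Fin n) K)} (F : MinimalResolution I) (i : ℕ) (j : ℤ) : ℕ :=
  Nat.card {k : Fin (F.rank i) // ∑ v, F.mdeg i k v = j}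

open Classical in
/-- The graded Betti number `β_{i,j}(I)`: the number of basis vectors of degree `j` in
homological degree `i` of a minimal multigraded free resolution of `I`. A monomial ideal has
such a resolution, and it is unique up to isomorphism. (The value `0` is used for ideals that
have none; these are not monomial.) -/
noncomputable def bettiNumber {K : Type*} [Field K] {n : ℕ}
    (I : Ideal (MvPolynomial (Fin n) K)) (i : ℕ) (j : ℤ) : ℕ :=
  if h : Nonempty (MinimalResolution I) then h.some.gradedRank i j else 0

/-- `r` is the Castelnuovo-Mumford regularity of `I`:
`r = max {j - i : β_{i,j}(I) ≠ 0}`, the maximum being attained. -/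
def IsRegularity {K : Type*} [Field K] {n : ℕ}
    (I : Ideal (MvPolynomial (Fin n) K)) (r : ℤ) : Prop :=
  IsGreatest {c : ℤ | ∃ (i : ℕ) (j : ℤ), bettiNumber I i j ≠ 0 ∧ c = j - i} r

/-- `I` has a linear resolution: for some `c`, `β_{i,j}(I) = 0` whenever `j - i ≠ c`. -/
def HasLinearResolution {K : Type*} [Field K] {n : ℕ}
    (I : Ideal (MvPolynomial (Fin n) K)) : Prop :=
  ∃ c : ℤ, ∀ (i : ℕ) (j : ℤ), j - i ≠ c → bettiNumber I i j = 0

end MonomialBetti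

/-! The variables of `A` are adjoined one at a time. Write `I_A` for `I + x^u (x_i : i ∈ A)` and let
`I : x^u` be generated by the variables in `B`. Then `I_A : x^u = (B ∪ A)`. A variable `x_i` with `i
∈ B ∪ A` adds nothing. Otherwise `x_i` is a nonzerodivisor modulo `J = (B ∪ A)`, so `I_A : x^u x_i =
J` as well, and `R / (I_A + (x^u x_i))` is resolved by the mapping cone of a lift of `x^u x_i : R/J
→ R/I_A`. Since `x^u J ⊆ I_A`, this lift can be taken to be `x_i` times a lift of `x^u`, so its
entries lie in the maximal ideal and the cone is minimal (`Resolution.exists_extension`). The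
resolution of `R/J` is linear and is shifted by `deg (x^u x_i) = d`, so only the strand `t - s = d`
changes, and it can only grow.

If `I ≠ 0`, that strand is already nonzero for `I` because `β_{0,d}(I) ≠ 0`. Hence `I` and `I'` have
the same set of values `t - s`, which gives both the regularity and the linearity statement. Betti
numbers are computed from any minimal resolution by `Resolution.bettiNumber_eq`. -/

namespace MonomialBetti

open MvPolynomial

/-! ### Multigraded components and graded maps of free modules. -/

section Grading

variable {K : Type*} [Field K] {n : ℕ}

/-- The component of multidegree `a` of a polynomial. -/
noncomputable def part (a : Fin n → ℤ) : MvPolynomial (Fin n) K →+ MvPolynomial (Fin n) K :=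
  (weightedHomogeneousComponent (fun v => (Pi.single v 1 : Fin n → ℤ)) a).toAddMonoidHom

open Classical in
theorem coeff_part (a : Fin n → ℤ) (f : MvPolynomial (Fin n) K) (m : Fin n →₀ ℕ) :
    coeff m (part a f) = if (fun v => (m v : ℤ)) = a then coeff m f else 0 := by
  have h : Finsupp.weight (fun v => (Pi.single v 1 : Fin n → ℤ)) m = fun v => (m v : ℤ) := by
    ext v
    rw [Finsupp.weight_apply, Finsupp.sum_fintype _ _ (by simp), Finset.sum_apply,
      Finset.sum_eq_single v]
    · simp
    · intro b _ hb
      simp [hb.symm]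
    · simp
  rw [← h]
  exact coeff_weightedHomogeneousComponent a f m

theorem isMultihomogeneous_iff (f : MvPolynomial (Fin n) K) (a : Fin n → ℤ) :
    IsMultihomogeneous f a ↔ part a f = f := by
  classical
  constructor
  · intro h
    ext m
    rw [coeff_part]
    split_ifs with hm
    · rfl
    · by_contra hc
      exact hm (funext fun v => h m (mem_support_iff.mpr (Ne.symm hc)) v)
  · intro h m hm v
    rw [mem_support_iff, ← h, coeff_part] at hm
    by_contra hc
    exact hm (if_neg fun h' => hc (congrFun h' v))

theorem part_part (a b : Fin n → ℤ) (f : MvPolynomial (Fin n) K) :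
    part a (part b f) = if a = b then part b f else 0 := by
  classical
  ext m
  rw [coeff_part]
  split_ifs with h1 h2 h2
  · rfl
  · rw [coeff_part, if_neg (h1 ▸ h2), coeff_zero]
  · rw [coeff_part, if_neg (h2 ▸ h1)]
  · rw [coeff_zero]

theorem part_mul (a c : Fin n → ℤ) (p q : MvPolynomial (Fin n) K) (hq : part a q = q) :
    part c (p * q) = part (c - a) p * q := by
  classical
  ext m
  have hite (P : Prop) [Decidable P] (s : Finset ((Fin n →₀ ℕ) × (Fin n →₀ ℕ)))
      (g : (Fin n →₀ ℕ) × (Fin n →₀ ℕ) → K) :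
      (if P then ∑ x ∈ s, g x else 0) = ∑ x ∈ s, if P then g x else 0 := by
    split_ifs <;> simp
  rw [coeff_part, coeff_mul, coeff_mul, hite]
  refine Finset.sum_congr rfl fun x hx => ?_
  rw [Finset.HasAntidiagonal.mem_antidiagonal] at hx
  rw [coeff_part, ← hq, coeff_part]
  by_cases h : (fun v => (x.2 v : ℤ)) = a
  · subst h
    have : ((fun v => (m v : ℤ)) = c) ↔ (fun v => (x.1 v : ℤ)) = c - fun v => (x.2 v : ℤ) := by
      rw [← hx, funext_iff, funext_iff]
      refine forall_congr' fun v => ?_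
      simp only [Finsupp.add_apply, Pi.sub_apply]
      push_cast
      omega
    simp [this]
  · simp [h]

theorem constantCoeff_part (a : Fin n → ℤ) (f : MvPolynomial (Fin n) K) :
    constantCoeff (part a f) = if a = 0 then constantCoeff f else 0 := by
  classical
  rw [constantCoeff_eq, coeff_part]
  refine if_congr ?_ rfl rfl
  constructor
  · rintro rfl
    ext; simp
  · rintro rfl
    ext; simp

theorem part_zero_eq_C (f : MvPolynomial (Fin n) K) : part 0 f = C (constantCoeff f) := by
  classical
  ext m
  rw [coeff_part, coeff_C, constantCoeff_eq]
  by_cases h : m = 0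
  · subst h
    rw [if_pos (by ext; simp), if_pos rfl]
  · rw [if_neg, if_neg (Ne.symm h)]
    intro h'
    exact h (Finsupp.ext fun v => by simpa using congrFun h' v)

theorem part_monomial (m : Fin n →₀ ℕ) (r : K) :
    part (fun v => (m v : ℤ)) (monomial m r) = monomial m r := by
  rw [← isMultihomogeneous_iff]
  intro m' hm v
  rw [Finset.mem_singleton.mp (support_monomial_subset hm)]

/-- Every monomial of `f` has exponent `a v` at `v`. This serves to bound the multidegrees of a
minimal resolution. -/
theorem X_dvd_of_part_eq (a : Fin n → ℤ) (f : MvPolynomial (Fin n) K) (hf : part a f = f)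
    (v : Fin n) (hv : 0 < a v) : X v ∣ f := by
  classical
  rw [X_dvd_iff_modMonomial_eq_zero]
  ext m
  rw [coeff_zero]
  by_cases h : Finsupp.single v 1 ≤ m
  · exact coeff_modMonomial_of_le _ h
  · rw [coeff_modMonomial_of_not_le _ h, ← hf, coeff_part, if_neg]
    rintro rfl
    refine h ?_
    rw [Finsupp.single_le_iff]
    exact Nat.cast_pos.mp hv

variable {κ ι : Type*}

/-- The component of multidegree `c` of a vector, the `l`-th basis vector having
multidegree `b l`. -/
noncomputable def comp (b : κ → Fin n → ℤ) (c : Fin n → ℤ) :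
    (κ → MvPolynomial (Fin n) K) →+ (κ → MvPolynomial (Fin n) K) where
  toFun w l := part (c - b l) (w l)
  map_zero' := by ext; simp
  map_add' w z := by ext; simp

@[simp]
theorem comp_apply (b : κ → Fin n → ℤ) (c : Fin n → ℤ) (w : κ → MvPolynomial (Fin n) K) (l : κ) :
    comp b c w l = part (c - b l) (w l) := rfl

theorem comp_comp (b : κ → Fin n → ℤ) (c c' : Fin n → ℤ) (w : κ → MvPolynomial (Fin n) K) :
    comp b c (comp b c' w) = if c = c' then comp b c' w else 0 := by
  ext1 l
  rw [comp_apply, comp_apply, part_part]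
  by_cases h : c = c'
  · simp [h]
  · simp [h]

theorem comp_smul (b : κ → Fin n → ℤ) (a c : Fin n → ℤ) (f : MvPolynomial (Fin n) K)
    (y : κ → MvPolynomial (Fin n) K) (hy : comp b a y = y) :
    comp b c (f • y) = part (c - a) f • y := by
  ext1 l
  rw [comp_apply, Pi.smul_apply, Pi.smul_apply, smul_eq_mul, smul_eq_mul,
    part_mul (a - b l) _ _ _ (congrFun hy l)]
  congr 3
  abel

theorem comp_smul' (b : κ → Fin n → ℤ) (a c : Fin n → ℤ) (f : MvPolynomial (Fin n) K)
    (hf : part a f = f) (y : κ → MvPolynomial (Fin n) K) :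
    comp b c (f • y) = f • comp b (c - a) y := by
  ext1 l
  simp only [comp_apply, Pi.smul_apply, smul_eq_mul]
  rw [mul_comm, part_mul a _ _ _ hf, mul_comm]
  congr 3
  abel

theorem comp_single [DecidableEq κ] (b : κ → Fin n → ℤ) (k : κ) :
    comp b (b k) (Pi.single k (1 : MvPolynomial (Fin n) K)) = Pi.single k 1 := by
  ext1 l
  rw [comp_apply]
  by_cases h : l = k
  · subst h
    simp [part_zero_eq_C]
  · simp [h]

theorem comp_shift (b : κ → Fin n → ℤ) (u c : Fin n → ℤ) (w : κ → MvPolynomial (Fin n) K) :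
    comp (fun k => b k + u) c w = comp b (c - u) w := by
  ext1 l
  simp only [comp_apply]
  congr 2
  abel

/-- A vector is the sum of its components. -/
theorem exists_sum_comp_eq [Fintype κ] (b : κ → Fin n → ℤ) (w : κ → MvPolynomial (Fin n) K) :
    ∃ T : Finset (Fin n → ℤ), ∑ c ∈ T, comp b c w = w := by
  classical
  refine ⟨Finset.univ.biUnion fun l => (w l).support.image fun m => (fun v => (m v : ℤ)) + b l, ?_⟩
  ext l m
  rw [Finset.sum_apply, coeff_sum]
  simp only [comp_apply, coeff_part]
  by_cases hm : coeff m (w l) = 0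
  · simp [hm]
  · rw [Finset.sum_eq_single ((fun v => (m v : ℤ)) + b l)]
    · simp
    · intro c _ hc
      rw [if_neg]
      intro h
      exact hc (by rw [h]; abel)
    · intro h
      refine absurd ?_ h
      rw [Finset.mem_biUnion]
      exact ⟨l, Finset.mem_univ _, Finset.mem_image_of_mem _ (mem_support_iff.mpr hm)⟩

/-- A linear map between free modules with multigraded bases preserves multidegrees. -/
def IsGradedMap (a : ι → Fin n → ℤ) (b : κ → Fin n → ℤ)
    (D : (ι → MvPolynomial (Fin n) K) →ₗ[MvPolynomial (Fin n) K] (κ → MvPolynomial (Fin n) K)) :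
    Prop :=
  ∀ c w, D (comp a c w) = comp b c (D w)

theorem isGradedMap_linearCombination [Fintype ι] (a : ι → Fin n → ℤ) (b : κ → Fin n → ℤ)
    (y : ι → κ → MvPolynomial (Fin n) K) (hy : ∀ k, comp b (a k) (y k) = y k) :
    IsGradedMap a b (Fintype.linearCombination (MvPolynomial (Fin n) K) y) := by
  intro c w
  rw [Fintype.linearCombination_apply, Fintype.linearCombination_apply, map_sum]
  refine Finset.sum_congr rfl fun k _ => ?_
  rw [comp_smul b (a k) _ _ _ (hy k), comp_apply]

theorem eq_linearCombination_single [Fintype ι] [DecidableEq ι] {M : Type*} [AddCommGroup M]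
    [Module (MvPolynomial (Fin n) K) M]
    (D : (ι → MvPolynomial (Fin n) K) →ₗ[MvPolynomial (Fin n) K] M) :
    D = Fintype.linearCombination (MvPolynomial (Fin n) K) fun k => D (Pi.single k 1) := by
  refine LinearMap.pi_ext' fun k => LinearMap.ext_ring ?_
  simp [Fintype.linearCombination_apply_single]

theorem isGradedMap_iff [Fintype ι] [DecidableEq ι] (a : ι → Fin n → ℤ) (b : κ → Fin n → ℤ)
    (D : (ι → MvPolynomial (Fin n) K) →ₗ[MvPolynomial (Fin n) K] (κ → MvPolynomial (Fin n) K)) :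
    IsGradedMap a b D ↔ ∀ k l, IsMultihomogeneous (D (Pi.single k 1) l) (a k - b l) := by
  constructor
  · intro h k l
    rw [isMultihomogeneous_iff]
    have := h (a k) (Pi.single k 1)
    rw [comp_single] at this
    exact (congrFun this l).symm
  · intro h
    rw [eq_linearCombination_single D]
    exact isGradedMap_linearCombination a b _ fun k => funext fun l =>
      (isMultihomogeneous_iff _ _).mp (h k l)

theorem constantCoeff_map [Fintype ι] [DecidableEq ι]
    (D : (ι → MvPolynomial (Fin n) K) →ₗ[MvPolynomial (Fin n) K] (κ → MvPolynomial (Fin n) K))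
    (w : ι → MvPolynomial (Fin n) K) (l : κ) :
    constantCoeff (D w l) = ∑ k, constantCoeff (w k) * constantCoeff (D (Pi.single k 1) l) := by
  conv_lhs => rw [eq_linearCombination_single D]
  simp [Fintype.linearCombination_apply, Finset.sum_apply]

/-- Projectivity of free modules: preimages of the basis vectors are cut down to their components of
the right multidegree, which remain preimages because both maps are graded. -/
theorem exists_graded_lift [Fintype ι] {μ : Type*} [Fintype μ]
    (a : ι → Fin n → ℤ) (b : κ → Fin n → ℤ) (c : μ → Fin n → ℤ)
    (g : (ι → MvPolynomial (Fin n) K) →ₗ[MvPolynomial (Fin n) K] (κ → MvPolynomial (Fin n) K))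
    (D : (μ → MvPolynomial (Fin n) K) →ₗ[MvPolynomial (Fin n) K] (κ → MvPolynomial (Fin n) K))
    (hg : IsGradedMap a b g) (hD : IsGradedMap c b D) (h : ∀ w, g w ∈ LinearMap.range D) :
    ∃ φ : (ι → MvPolynomial (Fin n) K) →ₗ[MvPolynomial (Fin n) K] (μ → MvPolynomial (Fin n) K),
      IsGradedMap a c φ ∧ ∀ w, D (φ w) = g w := by
  classical
  choose y hy using fun k => h (Pi.single k 1)
  refine ⟨Fintype.linearCombination _ fun k => comp c (a k) (y k),
    isGradedMap_linearCombination _ _ _ fun k => by rw [comp_comp, if_pos rfl], fun w => ?_⟩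
  rw [eq_linearCombination_single g, Fintype.linearCombination_apply,
    Fintype.linearCombination_apply, map_sum]
  refine Finset.sum_congr rfl fun k _ => ?_
  rw [map_smul, hD, hy, ← hg, comp_single]

/-- The ungraded lift suffices for homotopies, whose multidegrees play no role. -/
theorem exists_lift [Fintype ι] {M N : Type*} [AddCommGroup M] [AddCommGroup N]
    [Module (MvPolynomial (Fin n) K) M] [Module (MvPolynomial (Fin n) K) N]
    (g : (ι → MvPolynomial (Fin n) K) →ₗ[MvPolynomial (Fin n) K] N)
    (D : M →ₗ[MvPolynomial (Fin n) K] N) (h : ∀ w, g w ∈ LinearMap.range D) :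
    ∃ φ : (ι → MvPolynomial (Fin n) K) →ₗ[MvPolynomial (Fin n) K] M, ∀ w, D (φ w) = g w := by
  classical
  choose y hy using fun k => h (Pi.single k 1)
  refine ⟨Fintype.linearCombination _ y, fun w => ?_⟩
  rw [eq_linearCombination_single g, Fintype.linearCombination_apply,
    Fintype.linearCombination_apply, map_sum]
  refine Finset.sum_congr rfl fun k _ => ?_
  rw [map_smul, hy]

end Grading

/-! ### Comparison of minimal resolutions and invariance of Betti numbers. -/

section Resolutions

variable {K : Type*} [Field K] {n : ℕ}

/-- A minimal multigraded free resolution of `R / I`, with arbitrary finite index types for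
the bases. The module in position `0` is `R` itself, so that position `i + 1` corresponds to the
`i`-th module of a resolution of `I`. -/
structure Resolution (I : Ideal (MvPolynomial (Fin n) K)) where
  /-- the basis in position `i` -/
  ι : ℕ → Type
  /-- finiteness of the bases -/
  fintype : ∀ i, Fintype (ι i)
  /-- the basis vector in position `0` -/
  base : ι 0
  eq_base : ∀ k, k = base
  /-- the multidegrees of the basis vectors -/
  deg : ∀ i, ι i → Fin n → ℤ
  deg_base : deg 0 base = 0
  /-- the differentials -/
  D : ∀ i, (ι (i + 1) → MvPolynomial (Fin n) K) →ₗ[MvPolynomial (Fin n) K]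
    (ι i → MvPolynomial (Fin n) K)
  graded : ∀ i, IsGradedMap (deg (i + 1)) (deg i) (D i)
  mem_range_zero : ∀ w, w ∈ LinearMap.range (D 0) ↔ w base ∈ I
  exact : ∀ i, Function.Exact (D (i + 1)) (D i)
  minimal : ∀ i w l, constantCoeff (D (i + 1) w l) = 0

attribute [instance] Resolution.fintype

namespace Resolution

variable {I J : Ideal (MvPolynomial (Fin n) K)}

theorem D_D (F : Resolution I) (i : ℕ) (w) : F.D i (F.D (i + 1) w) = 0 :=
  (F.exact i).apply_apply_eq_zero w

theorem mem_range_succ (F : Resolution I) {i : ℕ} {w} (h : F.D i w = 0) :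
    w ∈ LinearMap.range (F.D (i + 1)) :=
  (F.exact i w).mp h

/-- The number of basis vectors of total degree `j` in position `i + 1`. -/
noncomputable def count (F : Resolution I) (i : ℕ) (j : ℤ) : ℕ :=
  Nat.card {k : F.ι (i + 1) // ∑ v, F.deg (i + 1) k v = j}

/-- Multiplication by a monomial carrying `J` into `I` lifts to a map of resolutions. -/
theorem exists_comparison (F : Resolution J) (G : Resolution I) (u : Fin n →₀ ℕ)
    (h : ∀ f ∈ J, monomial u 1 * f ∈ I) :
    ∃ φ : ∀ i, (F.ι i → MvPolynomial (Fin n) K) →ₗ[MvPolynomial (Fin n) K]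
        (G.ι i → MvPolynomial (Fin n) K),
      (∀ i, IsGradedMap (fun k => F.deg i k + fun v => (u v : ℤ)) (G.deg i) (φ i)) ∧
      (∀ i w, G.D i (φ (i + 1) w) = φ i (F.D i w)) ∧
      ∀ w, φ 0 w G.base = monomial u 1 * w F.base := by
  classical
  -- The range condition is exactly what is needed to lift once more, so it travels with the map
  -- through the recursion.
  let Stage : ℕ → Type _ := fun i =>
    {φ : (F.ι i → MvPolynomial (Fin n) K) →ₗ[MvPolynomial (Fin n) K]
        (G.ι i → MvPolynomial (Fin n) K) //
      IsGradedMap (fun k => F.deg i k + fun v => (u v : ℤ)) (G.deg i) φ ∧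
        ∀ w, φ (F.D i w) ∈ LinearMap.range (G.D i)}
  have step : ∀ i (p : Stage i), ∃ q : Stage (i + 1), ∀ w, G.D i (q.1 w) = p.1 (F.D i w) := by
    rintro i ⟨p, hp, hr⟩
    obtain ⟨q, hq, hqp⟩ := exists_graded_lift (fun k => F.deg (i + 1) k + fun v => (u v : ℤ))
      (G.deg i) (G.deg (i + 1)) (p ∘ₗ F.D i) (G.D i)
      (fun c w => by
        rw [comp_shift, LinearMap.comp_apply, F.graded, LinearMap.comp_apply, ← hp, comp_shift])
      (G.graded i) hr
    refine ⟨⟨q, hq, fun w => G.mem_range_succ ?_⟩, hqp⟩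
    rw [hqp, LinearMap.comp_apply, F.D_D, map_zero]
  let p₀ : (F.ι 0 → MvPolynomial (Fin n) K) →ₗ[MvPolynomial (Fin n) K]
      (G.ι 0 → MvPolynomial (Fin n) K) :=
    LinearMap.pi fun _ => (monomial u (1 : K)) • LinearMap.proj F.base
  have hp₀ : ∀ w l, p₀ w l = monomial u 1 * w F.base := fun w l => rfl
  choose next hnext using step
  let s : ∀ i, Stage i := fun i => Nat.rec ⟨p₀, by
    intro c w
    ext1 l
    rw [comp_apply, hp₀, hp₀, comp_apply, mul_comm, mul_comm (monomial u (1 : K)),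
      part_mul (fun v => (u v : ℤ)) _ _ _ (part_monomial u 1), G.eq_base l, G.deg_base,
      F.deg_base]
    simp, by
    intro w
    rw [G.mem_range_zero, hp₀]
    exact h _ ((F.mem_range_zero _).mp ⟨w, rfl⟩)⟩ next i
  exact ⟨fun i => (s i).1, fun i => (s i).2.1, fun i => hnext i (s i), fun w => hp₀ w _⟩

/-- An endomorphism of a minimal resolution over the identity is the identity modulo the
maximal ideal. -/
theorem constantCoeff_endomorphism (F : Resolution I)
    (χ : ∀ i, (F.ι i → MvPolynomial (Fin n) K) →ₗ[MvPolynomial (Fin n) K]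
        (F.ι i → MvPolynomial (Fin n) K))
    (hχ : ∀ i w, F.D i (χ (i + 1) w) = χ i (F.D i w)) (h₀ : ∀ w, χ 0 w = w) (i : ℕ) (w) (l) :
    constantCoeff (χ (i + 1) w l) = constantCoeff (w l) := by
  classical
  -- The `s` are the components of a homotopy from the identity to `χ`. The hypothesis on `s` is the
  -- homotopy relation in position `i` precomposed with `F.D i`.
  have lift : ∀ i (s : (F.ι i → MvPolynomial (Fin n) K) →ₗ[MvPolynomial (Fin n) K]
      (F.ι (i + 1) → MvPolynomial (Fin n) K)),
      (∀ w, χ i (F.D i w) = F.D i w + F.D i (s (F.D i w))) →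
      ∃ s' : (F.ι (i + 1) → MvPolynomial (Fin n) K) →ₗ[MvPolynomial (Fin n) K]
        (F.ι (i + 2) → MvPolynomial (Fin n) K),
        ∀ w, F.D (i + 1) (s' w) = χ (i + 1) w - w - s (F.D i w) := by
    intro i s hs
    obtain ⟨s', hs'⟩ := exists_lift (χ (i + 1) - LinearMap.id - s ∘ₗ F.D i) (F.D (i + 1))
      (fun w => F.mem_range_succ (by simp [hχ, hs]))
    exact ⟨s', hs'⟩
  have key : ∀ i, ∃ s : (F.ι i → MvPolynomial (Fin n) K) →ₗ[MvPolynomial (Fin n) K]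
      (F.ι (i + 1) → MvPolynomial (Fin n) K),
      (∀ w, χ i (F.D i w) = F.D i w + F.D i (s (F.D i w))) ∧
        ∀ w l, constantCoeff (s (F.D i w) l) = 0 := by
    intro i
    induction i with
    -- Minimality says nothing about `F.D 0`, which has unit entries when `I = R`. Here `χ 0` is the
    -- identity, so `s = 0` can be taken.
    | zero => exact ⟨0, by simp [h₀], by simp⟩
    | succ i ih =>
      obtain ⟨s, hs, -⟩ := ih
      obtain ⟨s', hs'⟩ := lift i s hs
      refine ⟨s', fun w => ?_, fun w l => ?_⟩
      · rw [hs', F.D_D, map_zero]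
        abel
      · rw [constantCoeff_map]
        simp [F.minimal]
  obtain ⟨s, hs, hs0⟩ := key i
  obtain ⟨s', hs'⟩ := lift i s hs
  have h1 : χ (i + 1) w = w + s (F.D i w) + F.D (i + 1) (s' w) := by
    rw [hs']
    abel
  rw [h1]
  simp [F.minimal, hs0]

/-- Comparison maps `F → G → F` over the identity compose to the identity modulo the maximal ideal.
Restricted to basis vectors of degree `j`, this factors an identity matrix through the degree `j`
part of `G`, and ranks are compared. -/
theorem count_le (F G : Resolution I) (i : ℕ) (j : ℤ) : F.count i j ≤ G.count i j := by
  classical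
  obtain ⟨φ, hφ, hφD, hφ0⟩ := F.exists_comparison G 0 (fun f hf => by simpa using hf)
  obtain ⟨ψ, hψ, hψD, hψ0⟩ := G.exists_comparison F 0 (fun f hf => by simpa using hf)
  have hid := F.constantCoeff_endomorphism (fun i => ψ i ∘ₗ φ i)
    (fun i w => by simp [hφD, hψD]) (fun w => by
      ext1 l
      rw [F.eq_base l, LinearMap.comp_apply, hψ0, hφ0]
      simp) i
  -- A multihomogeneous entry with nonzero constant term has multidegree zero.
  have hzero : ∀ l k, constantCoeff (φ (i + 1) (Pi.single k 1) l) ≠ 0 →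
      G.deg (i + 1) l = F.deg (i + 1) k := by
    intro l k h
    have h1 := hφ (i + 1) (F.deg (i + 1) k) (Pi.single k 1)
    rw [comp_shift] at h1
    have h0 : (fun v => (((0 : Fin n →₀ ℕ) v : ℕ) : ℤ)) = 0 := by ext; simp
    rw [h0, sub_zero, comp_single] at h1
    rw [h1, comp_apply, constantCoeff_part] at h
    by_contra hne
    exact h (if_neg fun h' => hne (sub_eq_zero.mp h').symm)
  let A : Matrix {l : G.ι (i + 1) // ∑ v, G.deg (i + 1) l v = j}
      {k : F.ι (i + 1) // ∑ v, F.deg (i + 1) k v = j} K :=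
    fun l k => constantCoeff (φ (i + 1) (Pi.single k.1 1) l.1)
  let B : Matrix {k : F.ι (i + 1) // ∑ v, F.deg (i + 1) k v = j}
      {l : G.ι (i + 1) // ∑ v, G.deg (i + 1) l v = j} K :=
    fun k l => constantCoeff (ψ (i + 1) (Pi.single l.1 1) k.1)
  have hBA : B * A = 1 := by
    ext k k'
    have h1 := hid (Pi.single k'.1 1) k.1
    rw [LinearMap.comp_apply, constantCoeff_map] at h1
    rw [Matrix.mul_apply, Matrix.one_apply]
    have h2 : constantCoeff ((Pi.single k'.1 1 : F.ι (i + 1) → MvPolynomial (Fin n) K) k.1)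
        = if k = k' then (1 : K) else 0 := by
      rw [Pi.single_apply]
      simp only [Subtype.ext_iff]
      split_ifs <;> simp
    rw [← h2, ← h1]
    rw [← Fintype.sum_subtype_add_sum_subtype (fun l => ∑ v, G.deg (i + 1) l v = j),
      Finset.sum_eq_zero (s := (Finset.univ : Finset {l // ¬ ∑ v, G.deg (i + 1) l v = j})), add_zero]
    · exact Finset.sum_congr rfl fun l _ => mul_comm _ _
    · intro l _
      by_contra hne
      exact l.2 (by rw [hzero l.1 k'.1 (left_ne_zero_of_mul hne)]; exact k'.2)
  have h1 := Matrix.rank_mul_le_left B A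
  rw [hBA, Matrix.rank_one] at h1
  have h2 := B.rank_le_card_width
  rw [count, count, Nat.card_eq_fintype_card, Nat.card_eq_fintype_card]
  exact h1.trans h2

theorem count_eq (F G : Resolution I) (i : ℕ) (j : ℤ) : F.count i j = G.count i j :=
  (F.count_le G i j).antisymm (G.count_le F i j)

theorem funLeft_single {α β : Type*} [DecidableEq α] [DecidableEq β] (e : α ≃ β) (k : β) :
    LinearMap.funLeft (MvPolynomial (Fin n) K) (MvPolynomial (Fin n) K) e (Pi.single k 1)
      = Pi.single (e.symm k) 1 := by
  ext1 x
  simp [LinearMap.funLeft_apply, Pi.single_apply, Equiv.eq_symm_apply]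

theorem exists_renumber_iff (F : Resolution I) (i : ℕ)
    (w : Fin (Fintype.card (F.ι (i + 1))) → MvPolynomial (Fin n) K) :
    LinearMap.funLeft (MvPolynomial (Fin n) K) _ (Fintype.equivFin _) w ∈ Set.range (F.D (i + 1)) ↔
      w ∈ Set.range (LinearMap.funLeft (MvPolynomial (Fin n) K) _ (Fintype.equivFin _).symm ∘ₗ
        F.D (i + 1) ∘ₗ LinearMap.funLeft (MvPolynomial (Fin n) K) _ (Fintype.equivFin _)) := by
  constructor
  · rintro ⟨z, hz⟩
    refine ⟨z ∘ (Fintype.equivFin _).symm, ?_⟩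
    have h1 : LinearMap.funLeft (MvPolynomial (Fin n) K) (MvPolynomial (Fin n) K)
        (Fintype.equivFin (F.ι (i + 2))) (z ∘ (Fintype.equivFin _).symm) = z := by
      ext1 x
      simp [LinearMap.funLeft_apply]
    simp only [LinearMap.comp_apply]
    rw [h1, hz]
    ext1 x
    simp [LinearMap.funLeft_apply]
  · rintro ⟨z, rfl⟩
    refine ⟨LinearMap.funLeft (MvPolynomial (Fin n) K) (MvPolynomial (Fin n) K)
      (Fintype.equivFin _) z, ?_⟩
    ext1 x
    simp [LinearMap.funLeft_apply]

/-- Numbering the bases. -/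
noncomputable def toMinimalResolution (F : Resolution I) : MinimalResolution I where
  rank i := Fintype.card (F.ι (i + 1))
  mdeg i k := F.deg (i + 1) ((Fintype.equivFin _).symm k)
  aug := LinearMap.proj F.base ∘ₗ F.D 0 ∘ₗ LinearMap.funLeft _ _ (Fintype.equivFin _)
  diff i := LinearMap.funLeft _ _ (Fintype.equivFin _).symm ∘ₗ F.D (i + 1) ∘ₗ
    LinearMap.funLeft _ _ (Fintype.equivFin _)
  aug_homogeneous k := by
    classical
    have := (isGradedMap_iff _ _ _).mp (F.graded 0) ((Fintype.equivFin _).symm k) F.base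
    rw [F.deg_base, sub_zero] at this
    rwa [← funLeft_single (Fintype.equivFin (F.ι 1))] at this
  diff_homogeneous i k l := by
    classical
    have := (isGradedMap_iff _ _ _).mp (F.graded (i + 1)) ((Fintype.equivFin _).symm k)
      ((Fintype.equivFin _).symm l)
    rwa [← funLeft_single (Fintype.equivFin (F.ι (i + 2)))] at this
  range_aug := by
    ext f
    constructor
    · rintro ⟨w, rfl⟩
      exact (F.mem_range_zero _).mp ⟨_, rfl⟩
    · intro hf
      obtain ⟨w, hw⟩ := (F.mem_range_zero fun _ => f).mpr hf
      refine ⟨w ∘ (Fintype.equivFin _).symm, ?_⟩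
      have h1 : LinearMap.funLeft (MvPolynomial (Fin n) K) (MvPolynomial (Fin n) K)
          (Fintype.equivFin (F.ι 1)) (w ∘ (Fintype.equivFin _).symm) = w := by
        ext1 x
        simp [LinearMap.funLeft_apply]
      simp only [LinearMap.comp_apply]
      rw [h1, hw]
      rfl
  exact_zero w := by
    let z := LinearMap.funLeft (MvPolynomial (Fin n) K) (MvPolynomial (Fin n) K)
      (Fintype.equivFin (F.ι 1)) w
    have h1 : F.D 0 z = 0 ↔ F.D 0 z F.base = 0 :=
      ⟨fun h => congrFun h _, fun h => funext fun l => by rw [F.eq_base l, h]; rfl⟩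
    refine h1.symm.trans ((F.exact 0 _).trans (F.exists_renumber_iff 0 w))
  exact_succ i w := by
    refine Iff.trans ?_ ((F.exact (i + 1) _).trans (F.exists_renumber_iff (i + 1) w))
    exact (LinearMap.funLeft_injective_of_surjective (MvPolynomial (Fin n) K)
      (MvPolynomial (Fin n) K) _ (Fintype.equivFin (F.ι (i + 1))).symm.surjective).eq_iff'
      (map_zero _)
  minimal i k l := F.minimal i _ _

end Resolution

namespace MinimalResolution

variable {I : Ideal (MvPolynomial (Fin n) K)}

/-- The bases of a minimal resolution of `I`, extended by the basis of `R`. -/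
def index (F : MinimalResolution I) : ℕ → Type
  | 0 => Unit
  | i + 1 => Fin (F.rank i)

/-- The resolution of `R / I` obtained from a resolution of `I`. -/
noncomputable def toResolution (F : MinimalResolution I) : Resolution I where
  ι := F.index
  fintype
    | 0 => inferInstanceAs (Fintype Unit)
    | i + 1 => inferInstanceAs (Fintype (Fin (F.rank i)))
  base := ()
  eq_base _ := rfl
  deg
    | 0 => fun _ => 0
    | i + 1 => F.mdeg i
  deg_base := rfl
  D
    | 0 => LinearMap.pi fun _ => F.aug
    | i + 1 => F.diff i
  graded
    | 0 => by
      refine (isGradedMap_iff (ι := Fin (F.rank 0)) (κ := Unit) (F.mdeg 0) (fun _ => 0)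
        (LinearMap.pi fun _ => F.aug)).mpr fun k l => ?_
      rw [sub_zero]
      exact F.aug_homogeneous k
    | i + 1 => (isGradedMap_iff (ι := Fin (F.rank (i + 1))) (κ := Fin (F.rank i)) (F.mdeg (i + 1))
        (F.mdeg i) (F.diff i)).mpr (F.diff_homogeneous i)
  mem_range_zero w := by
    refine Iff.trans ?_ (SetLike.ext_iff.mp F.range_aug (w ()))
    exact exists_congr fun z => ⟨fun h => congrFun h (), fun h => funext fun _ => h⟩
  exact
    | 0 => fun w => by
      refine Iff.trans ?_ (F.exact_zero w)
      exact ⟨fun h => congrFun h (), fun h => funext fun _ => h⟩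
    | i + 1 => F.exact_succ i
  minimal i w l :=
    (constantCoeff_map (F.diff i) w l).trans
      (Finset.sum_eq_zero fun k _ => mul_eq_zero_of_right _ (F.minimal i k l))

theorem count_toResolution (F : MinimalResolution I) (i : ℕ) (j : ℤ) :
    F.toResolution.count i j = F.gradedRank i j := rfl

end MinimalResolution

theorem Resolution.bettiNumber_eq {I : Ideal (MvPolynomial (Fin n) K)} (F : Resolution I) (i : ℕ)
    (j : ℤ) : bettiNumber I i j = F.count i j := by
  have h : Nonempty (MinimalResolution I) := ⟨F.toMinimalResolution⟩
  rw [bettiNumber, dif_pos h, ← MinimalResolution.count_toResolution]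
  exact Resolution.count_eq _ _ _ _

end Resolutions

/-! ### Existence of minimal multigraded resolutions. -/

section Existence

variable {K : Type*} [Field K] {n : ℕ}

theorem exists_homogeneous_generators {κ : Type*} [Fintype κ] (b : κ → Fin n → ℤ)
    (N : Submodule (MvPolynomial (Fin n) K) (κ → MvPolynomial (Fin n) K))
    (hN : ∀ c, ∀ w ∈ N, comp b c w ∈ N) :
    ∃ (r : ℕ) (a : Fin r → Fin n → ℤ) (y : Fin r → κ → MvPolynomial (Fin n) K),
      (∀ k, comp b (a k) (y k) = y k) ∧ Submodule.span _ (Set.range y) = N := by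
  have hspan : Submodule.span (MvPolynomial (Fin n) K) {w | w ∈ N ∧ ∃ c, comp b c w = w} = N := by
    apply le_antisymm
    · exact Submodule.span_le.mpr fun w hw => hw.1
    · intro w hw
      obtain ⟨T, hT⟩ := exists_sum_comp_eq b w
      rw [← hT]
      exact Submodule.sum_mem _ fun c _ => Submodule.subset_span
        ⟨hN c w hw, c, by rw [comp_comp, if_pos rfl]⟩
  obtain ⟨s, hs, hsN⟩ := (Submodule.fg_span_iff_fg_span_finset_subset _).mp
    (hspan ▸ IsNoetherian.noetherian N)
  choose a ha using fun k : s => (hs k.2).2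
  refine ⟨s.card, fun k => a (s.equivFin.symm k), fun k => s.equivFin.symm k,
    fun k => ha _, ?_⟩
  rw [← hspan, hsN]
  congr 1
  ext w
  constructor
  · rintro ⟨k, rfl⟩
    exact (s.equivFin.symm k).2
  · intro hw
    exact ⟨s.equivFin ⟨w, hw⟩, by simp⟩

/-- A multigraded submodule of a finite free module has a minimal multigraded free cover. -/
theorem exists_minimal_cover {κ : Type*} [Fintype κ] (b : κ → Fin n → ℤ)
    (N : Submodule (MvPolynomial (Fin n) K) (κ → MvPolynomial (Fin n) K))
    (hN : ∀ c, ∀ w ∈ N, comp b c w ∈ N) :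
    ∃ (r : ℕ) (a : Fin r → Fin n → ℤ)
      (D : (Fin r → MvPolynomial (Fin n) K) →ₗ[MvPolynomial (Fin n) K]
        (κ → MvPolynomial (Fin n) K)),
      IsGradedMap a b D ∧ LinearMap.range D = N ∧
        ∀ w, D w = 0 → ∀ l, constantCoeff (w l) = 0 := by
  classical
  -- A homogeneous generating family of least cardinality is used; a relation with a unit constant
  -- term would make one generator redundant.
  have hex := exists_homogeneous_generators b N hN
  obtain ⟨a, y, hy, hspan⟩ := Nat.find_spec hex
  have hmin := fun {m : ℕ} => Nat.find_min (m := m) hex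
  generalize Nat.find hex = r at a y hy hspan hmin
  have hgr := isGradedMap_linearCombination a b y hy
  refine ⟨r, a, _, hgr, by rw [Fintype.range_linearCombination, hspan], fun w hw l => ?_⟩
  by_contra hc
  obtain _ | r := r
  · exact l.elim0
  refine hmin (Nat.lt_succ_self r)
    ⟨fun k => a (l.succAbove k), fun k => y (l.succAbove k), fun k => hy _, ?_⟩
  set S := Submodule.span (MvPolynomial (Fin n) K) (Set.range fun k => y (l.succAbove k)) with hS
  have hmem : ∀ k, y (l.succAbove k) ∈ S := fun k => Submodule.subset_span ⟨k, rfl⟩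
  -- In the component of degree `a l` of the relation, the coefficient of `y l` is the nonzero
  -- scalar `constantCoeff (w l)`, which can be inverted.
  have h1 := hgr (a l) w
  rw [hw, map_zero, Fintype.linearCombination_apply, Fin.sum_univ_succAbove _ l, comp_apply,
    sub_self, part_zero_eq_C, add_eq_zero_iff_eq_neg] at h1
  have h2 : (C (constantCoeff (w l)) : MvPolynomial (Fin n) K) • y l ∈ S := by
    rw [h1]
    exact S.neg_mem (S.sum_mem fun k _ => S.smul_mem _ (hmem k))
  have h3 := S.smul_mem (C (constantCoeff (w l))⁻¹ : MvPolynomial (Fin n) K) h2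
  rw [smul_smul, ← C_mul, inv_mul_cancel₀ hc, C_1, one_smul] at h3
  refine le_antisymm (Submodule.span_le.mpr ?_) ?_
  · rintro _ ⟨k, rfl⟩
    exact hspan ▸ Submodule.subset_span ⟨_, rfl⟩
  · rw [← hspan, Submodule.span_le]
    rintro _ ⟨k, rfl⟩
    rcases Fin.eq_self_or_eq_succAbove l k with rfl | ⟨k', rfl⟩
    · exact h3
    · exact hmem k'

/-- A finite free module with a multigraded basis together with a multigraded submodule. -/
structure GradedPair (K : Type*) [Field K] (n : ℕ) where
  /-- the rank -/
  rank : ℕ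
  /-- the multidegrees of the basis -/
  deg : Fin rank → Fin n → ℤ
  /-- the submodule -/
  N : Submodule (MvPolynomial (Fin n) K) (Fin rank → MvPolynomial (Fin n) K)
  comp_mem : ∀ c, ∀ w ∈ N, comp deg c w ∈ N

theorem GradedPair.exists_next (P : GradedPair K n) :
    ∃ (Q : GradedPair K n) (D : (Fin Q.rank → MvPolynomial (Fin n) K) →ₗ[MvPolynomial (Fin n) K]
      (Fin P.rank → MvPolynomial (Fin n) K)), IsGradedMap Q.deg P.deg D ∧
      LinearMap.range D = P.N ∧ Q.N = LinearMap.ker D ∧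
        ∀ w ∈ Q.N, ∀ l, constantCoeff (w l) = 0 := by
  obtain ⟨r, a, D, hD, hr, hk⟩ := exists_minimal_cover P.deg P.N P.comp_mem
  exact ⟨⟨r, a, LinearMap.ker D, fun c w hw => by
    rw [LinearMap.mem_ker, hD, LinearMap.mem_ker.mp hw, map_zero]⟩, D, hD, hr, rfl, hk⟩

/-- A multigraded ideal has a minimal multigraded free resolution. -/
theorem exists_resolution (I : Ideal (MvPolynomial (Fin n) K))
    (hI : ∀ c, ∀ f ∈ I, part c f ∈ I) : Nonempty (Resolution I) := by
  choose next D hD hr hN hmin using fun P : GradedPair K n => P.exists_next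
  let P₀ : GradedPair K n :=
    ⟨1, fun _ => 0, Submodule.comap (LinearMap.proj 0) I, fun c w hw => hI _ _ hw⟩
  -- `P i` is the `i`-th free module together with the submodule to be covered next: `I` for `i =
  -- 0`, afterwards the kernel of the preceding differential.
  let P : ℕ → GradedPair K n := fun i => Nat.rec P₀ (fun _ => next) i
  exact ⟨{
    ι := fun i => Fin (P i).rank
    fintype := fun i => inferInstance
    base := (0 : Fin 1)
    eq_base := fun k => Subsingleton.elim (α := Fin 1) _ _
    deg := fun i => (P i).deg
    deg_base := rfl
    D := fun i => D (P i)
    graded := fun i => hD (P i)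
    mem_range_zero := fun w => by
      rw [hr (P 0)]
      rfl
    exact := fun i w => by
      have h1 := SetLike.ext_iff.mp (hr (P (i + 1))) w
      have h2 := SetLike.ext_iff.mp (hN (P i)) w
      exact (h1.trans h2).symm
    minimal := fun i w l => by
      refine hmin (P i) _ ?_ l
      have h1 := SetLike.ext_iff.mp (hr (P (i + 1))) (D (P (i + 1)) w)
      exact h1.mp ⟨w, rfl⟩ }⟩

theorem part_mem_of_generated {I : Ideal (MvPolynomial (Fin n) K)} {d : ℕ}
    (hI : IsMonomialGeneratedInDegree I d) (c : Fin n → ℤ) (f) (hf : f ∈ I) : part c f ∈ I := by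
  classical
  obtain ⟨S, -, rfl⟩ := hI
  rw [monomialIdeal, mem_ideal_span_monomial_image] at hf ⊢
  intro m hm
  refine hf m ?_
  rw [mem_support_iff, coeff_part] at hm
  exact mem_support_iff.mpr fun h => hm (by simp [h])

end Existence

/-! ### Mapping cones. -/

section Cone

variable {K : Type*} [Field K] {n : ℕ}

/-- The resolution of `R / 0`. -/
noncomputable def Resolution.bot : Resolution (⊥ : Ideal (MvPolynomial (Fin n) K)) where
  ι
    | 0 => Unit
    | _ + 1 => Empty
  fintype
    | 0 => inferInstanceAs (Fintype Unit)
    | _ + 1 => inferInstanceAs (Fintype Empty)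
  base := ()
  eq_base _ := rfl
  deg _ _ := 0
  deg_base := rfl
  D _ := 0
  graded i c w := by simp
  mem_range_zero w := by
    rw [LinearMap.range_zero, Submodule.mem_bot, Submodule.mem_bot]
    exact ⟨fun h => congrFun h (), fun h => funext fun _ => h⟩
  exact i w := by
    have : w = 0 := funext fun k => Empty.elim k
    simp [this]
  minimal i w l := by simp

variable {I J : Ideal (MvPolynomial (Fin n) K)} (F : Resolution I) (G : Resolution J)

/-- The bases of the mapping cone of a map from `G` to `F` which is multiplication by a monomial
in position `0`. -/
def coneIndex : ℕ → Type
  | 0 => Unit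
  | i + 1 => F.ι (i + 1) ⊕ G.ι i

/-- The multidegrees of the basis of the mapping cone of a map of multidegree `e`. -/
def coneDeg (e : Fin n → ℤ) : ∀ i, coneIndex F G i → Fin n → ℤ
  | 0, _ => 0
  | i + 1, k => Sum.elim (F.deg (i + 1)) (fun l => G.deg i l + e) k

variable (α : ∀ i, (G.ι i → MvPolynomial (Fin n) K) →ₗ[MvPolynomial (Fin n) K]
  (F.ι i → MvPolynomial (Fin n) K))

/-- The differential of the mapping cone. -/
noncomputable def coneD : ∀ i, (coneIndex F G (i + 1) → MvPolynomial (Fin n) K)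
    →ₗ[MvPolynomial (Fin n) K] (coneIndex F G i → MvPolynomial (Fin n) K)
  | 0 => LinearMap.pi fun _ => LinearMap.proj F.base ∘ₗ
      (F.D 0 ∘ₗ LinearMap.funLeft _ _ Sum.inl + α 0 ∘ₗ LinearMap.funLeft _ _ Sum.inr)
  | i + 1 => LinearMap.pi fun k => Sum.elim
      (fun l => LinearMap.proj l ∘ₗ
        (F.D (i + 1) ∘ₗ LinearMap.funLeft _ _ Sum.inl + α (i + 1) ∘ₗ LinearMap.funLeft _ _ Sum.inr))
      (fun l => -(LinearMap.proj l ∘ₗ G.D i ∘ₗ LinearMap.funLeft _ _ Sum.inr)) k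

theorem coneD_zero (f : F.ι 1 → MvPolynomial (Fin n) K) (g : G.ι 0 → MvPolynomial (Fin n) K) :
    coneD F G α 0 (Sum.elim f g) = fun _ => (F.D 0 f + α 0 g) F.base := rfl

theorem coneD_succ (i : ℕ) (f : F.ι (i + 2) → MvPolynomial (Fin n) K)
    (g : G.ι (i + 1) → MvPolynomial (Fin n) K) :
    coneD F G α (i + 1) (Sum.elim f g) = Sum.elim (F.D (i + 1) f + α (i + 1) g) (-(G.D i g)) := by
  ext1 k
  rcases k with k | k <;> rfl

theorem exists_sumElim {ι κ : Type*} {M : Type*} (w : ι ⊕ κ → M) :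
    ∃ f g, w = Sum.elim f g :=
  ⟨_, _, (Sum.elim_comp_inl_inr w).symm⟩

theorem comp_sumElim {ι κ : Type*} (a : ι → Fin n → ℤ) (b : κ → Fin n → ℤ) (c : Fin n → ℤ)
    (f : ι → MvPolynomial (Fin n) K) (g : κ → MvPolynomial (Fin n) K) :
    comp (Sum.elim a b) c (Sum.elim f g) = Sum.elim (comp a c f) (comp b c g) := by
  ext1 k
  rcases k with k | k <;> rfl

/-- The mapping cone of a minimal comparison map. -/
noncomputable def Resolution.cone (m : Fin n →₀ ℕ)
    (hα : ∀ i, IsGradedMap (fun k => G.deg i k + fun v => (m v : ℤ)) (F.deg i) (α i))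
    (hαD : ∀ i w, F.D i (α (i + 1) w) = α i (G.D i w))
    (hα₀ : ∀ w, α 0 w F.base = monomial m 1 * w G.base)
    (hmin : ∀ i w l, constantCoeff (α (i + 1) w l) = 0)
    (hJ : ∀ f, monomial m 1 * f ∈ I → f ∈ J) (hJ₀ : ∀ f ∈ J, constantCoeff f = 0) :
    Resolution (I ⊔ Ideal.span {monomial m (1 : K)}) where
  ι := coneIndex F G
  fintype
    | 0 => inferInstanceAs (Fintype Unit)
    | i + 1 => inferInstanceAs (Fintype (F.ι (i + 1) ⊕ G.ι i))
  base := ()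
  eq_base _ := rfl
  deg := coneDeg F G fun v => (m v : ℤ)
  deg_base := rfl
  D := coneD F G α
  graded i c w := by
    obtain ⟨f, g, rfl⟩ := exists_sumElim w
    obtain _ | i := i
    · refine (congrArg _ (comp_sumElim _ _ c f g)).trans ?_
      rw [coneD_zero, coneD_zero, F.graded, hα, ← map_add]
      ext1 l
      rw [comp_apply, comp_apply, F.deg_base]
      rfl
    · refine (congrArg _ (comp_sumElim _ _ c f g)).trans ?_
      rw [coneD_succ, coneD_succ, F.graded, hα, ← map_add, comp_shift, G.graded, ← map_neg,
        ← comp_shift]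
      exact (comp_sumElim _ _ c _ _).symm
  mem_range_zero w := by
    rw [Submodule.mem_sup]
    constructor
    · rintro ⟨z, rfl⟩
      obtain ⟨f, g, rfl⟩ := exists_sumElim z
      refine ⟨_, (F.mem_range_zero _).mp ⟨f, rfl⟩, _, Ideal.mem_span_singleton.mpr ⟨_, hα₀ g⟩, rfl⟩
    · rintro ⟨x, hx, y, hy, hxy⟩
      obtain ⟨f, hf⟩ := (F.mem_range_zero fun _ => x).mpr hx
      obtain ⟨z, rfl⟩ := Ideal.mem_span_singleton.mp hy
      refine ⟨Sum.elim f fun _ => z, funext fun _ => ?_⟩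
      rw [coneD_zero, hf, Pi.add_apply, hα₀]
      exact hxy
  exact i w := by
    obtain ⟨f, g, rfl⟩ := exists_sumElim w
    constructor
    · intro h
      -- In position `0` this is the colon condition `hJ`; above it is exactness of `G`.
      have key : ∃ g', G.D i g' = g := by
        obtain _ | i := i
        · rw [coneD_zero] at h
          have h0 := congrFun h ()
          rw [Pi.add_apply, hα₀] at h0
          refine (G.mem_range_zero g).mpr (hJ _ ?_)
          rw [eq_neg_of_add_eq_zero_right h0]
          exact I.neg_mem ((F.mem_range_zero _).mp ⟨f, rfl⟩)
        · rw [coneD_succ] at h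
          refine G.mem_range_succ (neg_eq_zero.mp ?_)
          exact funext fun l => congrFun h (Sum.inr l)
      have hfg : F.D i f + α i g = 0 := by
        obtain _ | i := i
        · rw [coneD_zero] at h
          exact funext fun l => F.eq_base l ▸ congrFun h ()
        · rw [coneD_succ] at h
          exact funext fun l => congrFun h (Sum.inl l)
      obtain ⟨g', rfl⟩ := key
      rw [← hαD, ← map_add] at hfg
      obtain ⟨f', hf'⟩ := F.mem_range_succ hfg
      -- The sign compensates for the sign of `G.D` in the cone differential.
      refine ⟨Sum.elim f' (-g'), ?_⟩
      rw [coneD_succ, hf', map_neg, map_neg, neg_neg, add_neg_cancel_right]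
    · rintro ⟨z, hz⟩
      obtain ⟨f', g', rfl⟩ := exists_sumElim z
      rw [← hz, coneD_succ]
      obtain _ | i := i
      · rw [coneD_zero, map_neg, map_add, F.D_D, zero_add, hαD, add_neg_cancel]
        rfl
      · rw [coneD_succ, map_neg, map_neg, map_add, F.D_D, G.D_D, zero_add, hαD, add_neg_cancel,
          neg_zero, neg_zero]
        exact funext fun k => by rcases k with k | k <;> rfl
  minimal i w l := by
    obtain ⟨f, g, rfl⟩ := exists_sumElim w
    rw [coneD_succ]
    rcases l with l | l
    · rw [Sum.elim_inl, Pi.add_apply, map_add, F.minimal, hmin, add_zero]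
    · rw [Sum.elim_inr, Pi.neg_apply, map_neg, neg_eq_zero]
      -- `G.minimal` does not cover `G.D 0`; its values lie in `J`, which has no constant terms by
      -- `hJ₀`.
      obtain _ | i := i
      · rw [G.eq_base l]
        exact hJ₀ _ ((G.mem_range_zero _).mp ⟨g, rfl⟩)
      · exact G.minimal i g l

end Cone

/-! ### Adjoining one variable multiple of `x^u` at a time. -/

section Extension

variable {K : Type*} [Field K] {n : ℕ} {I J : Ideal (MvPolynomial (Fin n) K)}

/-- If `x^u J ⊆ I` and `I : x^u x_i ⊆ J`, a minimal resolution of `I + (x^u x_i)` is the mapping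
cone of minimal resolutions of `I` and `J`. -/
theorem Resolution.exists_extension (F : Resolution I) (G : Resolution J) (u : Fin n →₀ ℕ)
    (i : Fin n) (huJ : ∀ f ∈ J, monomial u 1 * f ∈ I)
    (hJ : ∀ f, monomial (u + Finsupp.single i 1) 1 * f ∈ I → f ∈ J)
    (hJ₀ : ∀ f ∈ J, constantCoeff f = 0) :
    ∃ H : Resolution (I ⊔ Ideal.span {monomial (u + Finsupp.single i 1) (1 : K)}),
      ∀ s, ∃ e : F.ι (s + 1) ⊕ G.ι s ≃ H.ι (s + 1),
        (∀ k, H.deg (s + 1) (e (Sum.inl k)) = F.deg (s + 1) k) ∧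
        ∀ k, H.deg (s + 1) (e (Sum.inr k)) =
          G.deg s k + fun v => (((u + Finsupp.single i 1 : Fin n →₀ ℕ) v : ℕ) : ℤ) := by
  obtain ⟨φ, hφ, hφD, hφ0⟩ := G.exists_comparison F u huJ
  have hX : part (fun v => ((Finsupp.single i 1 : Fin n →₀ ℕ) v : ℤ))
      (X i : MvPolynomial (Fin n) K) = X i := part_monomial (Finsupp.single i 1) 1
  -- `φ` lifts multiplication by `x^u`; the extra factor `X i` puts all entries into the maximal
  -- ideal, which makes the cone minimal.
  let α : ∀ s, (G.ι s → MvPolynomial (Fin n) K) →ₗ[MvPolynomial (Fin n) K]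
      (F.ι s → MvPolynomial (Fin n) K) := fun s => (X i : MvPolynomial (Fin n) K) • φ s
  have hα : ∀ s w, α s w = (X i : MvPolynomial (Fin n) K) • φ s w := fun s w => rfl
  have h1 : ∀ s, IsGradedMap
      (fun k => G.deg s k + fun v => (((u + Finsupp.single i 1 : Fin n →₀ ℕ) v : ℕ) : ℤ))
      (F.deg s) (α s) := by
    intro s c w
    rw [hα, hα, comp_smul' _ _ _ _ hX, ← hφ, comp_shift, comp_shift]
    congr 4
    ext v
    simp only [Pi.sub_apply, Finsupp.add_apply]
    push_cast
    ring
  have h2 : ∀ s w, F.D s (α (s + 1) w) = α s (G.D s w) := fun s w => by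
    rw [hα, hα, map_smul, hφD]
  have h3 : ∀ w, α 0 w F.base = monomial (u + Finsupp.single i 1) 1 * w G.base := fun w => by
    rw [hα, Pi.smul_apply, hφ0, smul_eq_mul, ← mul_assoc, X, monomial_mul, add_comm, one_mul]
  have h4 : ∀ s w l, constantCoeff (α (s + 1) w l) = 0 := fun s w l => by
    rw [hα, Pi.smul_apply, smul_eq_mul, map_mul, constantCoeff_X, zero_mul]
  exact ⟨F.cone G α (u + Finsupp.single i 1) h1 h2 h3 h4 hJ hJ₀,
    fun s => ⟨Equiv.refl _, fun _ => rfl, fun _ => rfl⟩⟩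

theorem constantCoeff_of_mem_variableIdeal (A : Set (Fin n)) (f : MvPolynomial (Fin n) K)
    (hf : f ∈ variableIdeal K A) : constantCoeff f = 0 := by
  by_contra h
  rw [constantCoeff_eq, ← ne_eq, ← mem_support_iff] at h
  obtain ⟨i, -, hi⟩ := mem_ideal_span_X_image.mp hf _ h
  exact hi rfl

/-- A variable outside `A` is a nonzerodivisor modulo `(A)`, so the colon ideal by it is again
`(A)`. Both inductions below rest on this. -/
theorem mem_variableIdeal_of_X_mul_mem (A : Set (Fin n)) (i : Fin n) (hi : i ∉ A)
    (f : MvPolynomial (Fin n) K) (hf : X i * f ∈ variableIdeal K A) : f ∈ variableIdeal K A := by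
  classical
  refine mem_ideal_span_X_image.mpr fun m hm => ?_
  obtain ⟨j, hj, hmj⟩ := mem_ideal_span_X_image.mp hf (Finsupp.single i 1 + m) (by
    rw [mem_support_iff] at hm ⊢
    rwa [coeff_X_mul])
  refine ⟨j, hj, ?_⟩
  have : i ≠ j := fun h => hi (h ▸ hj)
  simpa [this] using hmj

theorem variableIdeal_insert (i : Fin n) (A : Set (Fin n)) :
    variableIdeal K (insert i A) = variableIdeal K A ⊔ Ideal.span {X i} := by
  rw [variableIdeal, variableIdeal, Set.image_insert_eq, Ideal.span_insert, sup_comm]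

theorem variableIdeal_union (A B : Set (Fin n)) :
    variableIdeal K (A ∪ B) = variableIdeal K A ⊔ variableIdeal K B := by
  rw [variableIdeal, variableIdeal, variableIdeal, Set.image_union, Ideal.span_union]

theorem cast_degree_eq_sum (m : Fin n →₀ ℕ) : ((m.degree : ℕ) : ℤ) = ∑ v, (m v : ℤ) := by
  rw [Finsupp.degree_eq_sum]
  push_cast
  rfl

/-- Ideals generated by variables have a linear resolution. -/
theorem exists_linear_resolution_variableIdeal (A : Set (Fin n)) :
    ∃ T : Resolution (variableIdeal K A), ∀ s k, ∑ v, T.deg s k v = s := by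
  induction A, A.toFinite using Set.Finite.induction_on with
  | empty =>
    have h : variableIdeal K (∅ : Set (Fin n)) = ⊥ := by simp [variableIdeal]
    rw [h]
    refine ⟨Resolution.bot, fun s k => ?_⟩
    obtain _ | s := s
    · exact Finset.sum_eq_zero fun _ _ => rfl
    · exact Empty.elim k
  | @insert i A hi _ ih =>
    obtain ⟨T, hT⟩ := ih
    -- With `u = 0` and both ideals equal to `(A)`, this is the inductive step of the Koszul
    -- complex: the cone of `x_i` on `T`.
    obtain ⟨H, hH⟩ := T.exists_extension T 0 i (fun f hf => Ideal.mul_mem_left _ _ hf)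
      (fun f hf => mem_variableIdeal_of_X_mul_mem A i hi f (by rwa [zero_add] at hf))
      (constantCoeff_of_mem_variableIdeal A)
    have hI : variableIdeal K (insert i A) =
        variableIdeal K A ⊔ Ideal.span {monomial (0 + Finsupp.single i 1) (1 : K)} := by
      rw [variableIdeal_insert, zero_add, X]
    rw [hI]
    refine ⟨H, fun s k => ?_⟩
    obtain _ | s := s
    · rw [H.eq_base k, H.deg_base]
      simp
    · obtain ⟨e, hel, her⟩ := hH s
      obtain ⟨k | k, rfl⟩ := e.surjective k
      · rw [hel, hT]
      · rw [her]
        simp only [Pi.add_apply, Finset.sum_add_distrib]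
        rw [hT, ← cast_degree_eq_sum, zero_add, Finsupp.degree_single]
        push_cast
        rfl

/-- Adding multiples of `x^u` by variables only changes the linear strand. -/
theorem IsStronglyLinear.exists_resolution {d : ℕ} {u : Fin n →₀ ℕ} (hu : IsStronglyLinear I d u)
    (F : Resolution I) (A : Set (Fin n)) :
    ∃ H : Resolution (I + Ideal.span {monomial u (1 : K)} * variableIdeal K A),
      ∀ (s : ℕ) (t : ℤ), F.count s t ≤ H.count s t ∧ (t - s ≠ d → H.count s t = F.count s t) := by
  obtain ⟨B, hB⟩ := hu.colon_eq
  have hB' : ∀ f, f ∈ variableIdeal K B ↔ monomial u 1 * f ∈ I := fun f => by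
    rw [← hB, Submodule.mem_colon_singleton, smul_eq_mul, mul_comm]
  -- The colon ideal stays generated by variables: `I_A : x^u = (B ∪ A)`.
  have hmem : ∀ A f, f ∈ variableIdeal K (B ∪ A) ↔
      monomial u 1 * f ∈ I + Ideal.span {monomial u (1 : K)} * variableIdeal K A := by
    intro A f
    rw [variableIdeal_union, Submodule.add_eq_sup, Submodule.mem_sup, Submodule.mem_sup]
    constructor
    · rintro ⟨b, hb, a, ha, rfl⟩
      exact ⟨_, (hB' b).mp hb, _, Ideal.mul_mem_mul (Ideal.mem_span_singleton_self _) ha,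
        (mul_add _ _ _).symm⟩
    · rintro ⟨x, hx, y, hy, hxy⟩
      obtain ⟨g, hg, rfl⟩ := Ideal.mem_span_singleton_mul.mp hy
      refine ⟨f - g, (hB' _).mpr ?_, g, hg, sub_add_cancel _ _⟩
      rwa [mul_sub, ← hxy, add_sub_cancel_right]
  induction A, A.toFinite using Set.Finite.induction_on with
  | empty =>
    have h : I + Ideal.span {monomial u (1 : K)} * variableIdeal K (∅ : Set (Fin n)) = I := by
      simp [variableIdeal]
    rw [h]
    exact ⟨F, fun s t => ⟨le_rfl, fun _ => rfl⟩⟩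
  | @insert i A _ _ ih =>
    obtain ⟨H, hH⟩ := ih
    have hX : monomial (u + Finsupp.single i 1) (1 : K) = monomial u 1 * X i := by
      rw [X, monomial_mul, one_mul]
    have hins : I + Ideal.span {monomial u (1 : K)} * variableIdeal K (insert i A) =
        (I + Ideal.span {monomial u (1 : K)} * variableIdeal K A) ⊔
          Ideal.span {monomial (u + Finsupp.single i 1) (1 : K)} := by
      rw [variableIdeal_insert, Ideal.mul_sup, Ideal.span_singleton_mul_span_singleton, hX,
        Submodule.add_eq_sup, Submodule.add_eq_sup, sup_assoc]
    rw [hins]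
    by_cases hi : i ∈ B ∪ A
    · have hle : Ideal.span {monomial (u + Finsupp.single i 1) (1 : K)} ≤
          I + Ideal.span {monomial u (1 : K)} * variableIdeal K A := by
        rw [Ideal.span_le, Set.singleton_subset_iff, hX]
        exact (hmem A _).mp (Ideal.subset_span ⟨i, hi, rfl⟩)
      rw [sup_eq_left.mpr hle]
      exact ⟨H, hH⟩
    · obtain ⟨T, hT⟩ := exists_linear_resolution_variableIdeal (K := K) (B ∪ A)
      obtain ⟨H', hH'⟩ := H.exists_extension T u i (fun f hf => (hmem A f).mp hf)
        (fun f hf => mem_variableIdeal_of_X_mul_mem _ i hi f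
          ((hmem A _).mpr (by rwa [hX, mul_assoc] at hf)))
        (constantCoeff_of_mem_variableIdeal _)
      refine ⟨H', fun s t => ?_⟩
      obtain ⟨e, hel, her⟩ := hH' s
      let j : {k : H.ι (s + 1) // ∑ v, H.deg (s + 1) k v = t} →
          {k : H'.ι (s + 1) // ∑ v, H'.deg (s + 1) k v = t} :=
        fun k => ⟨e (Sum.inl k.1), by rw [hel]; exact k.2⟩
      have hj : Function.Injective j := fun k k' h =>
        Subtype.ext (Sum.inl_injective (e.injective (Subtype.ext_iff.mp h)))
      refine ⟨(hH s t).1.trans (Nat.card_le_card_of_injective j hj), fun hst => ?_⟩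
      rw [← (hH s t).2 hst]
      refine (Nat.card_congr (Equiv.ofBijective j ⟨hj, ?_⟩)).symm
      rintro ⟨k, hk⟩
      obtain ⟨k | k, rfl⟩ := e.surjective k
      · exact ⟨⟨k, by rwa [hel] at hk⟩, rfl⟩
      -- A vector coming from position `s` of `T` has degree `s`, and `s + d` after the shift. It
      -- sits in position `s + 1` of `H'`, that is, in homological degree `s` for the ideal, so it
      -- lies on the strand `t - s = d`.
      · refine absurd ?_ hst
        rw [her] at hk
        simp only [Pi.add_apply, Finset.sum_add_distrib] at hk
        rw [hT, ← cast_degree_eq_sum] at hk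
        have hdeg := hu.degree_add_one
        rw [← hk, ← hdeg, map_add, Finsupp.degree_single]
        push_cast
        ring

end Extension

/-! ### The strand of the generators, and boundedness of multidegrees. -/

section Regularity

variable {K : Type*} [Field K] {n : ℕ} {I : Ideal (MvPolynomial (Fin n) K)}

/-- A basis vector is not congruent to an element of the maximal ideal times the module modulo
the kernel of the differential. -/
theorem Resolution.constantCoeff_ne_zero_of_D_eq (F : Resolution I) [∀ i, DecidableEq (F.ι i)]
    {i : ℕ} {k : F.ι (i + 1)} {w : F.ι (i + 1) → MvPolynomial (Fin n) K}
    (h : F.D i (Pi.single k 1) = F.D i w) : constantCoeff (w k) ≠ 0 := by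
  intro hw
  obtain ⟨z, hz⟩ := F.mem_range_succ (w := Pi.single k 1 - w) (by rw [map_sub, h, sub_self])
  have := F.minimal i z k
  rw [hz, Pi.sub_apply, map_sub, hw] at this
  simp at this

/-- The image of a basis vector is a scalar multiple of a monomial `x^m`, and some generator `x^s`
of `I` divides `x^m`. If `s ≠ m`, the basis vector would agree, modulo the kernel, with a vector
having coefficients in the maximal ideal, contradicting minimality. -/
theorem Resolution.exists_deg_one_eq (F : Resolution I) {d : ℕ}
    (hI : IsMonomialGeneratedInDegree I d) (k : F.ι 1) :
    ∃ m : Fin n →₀ ℕ, m.degree = d ∧ ∀ v, F.deg 1 k v = m v := by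
  classical
  obtain ⟨S, hS, hIS⟩ := hI
  set f := F.D 0 (Pi.single k 1) F.base with hf
  have hfh : IsMultihomogeneous f (F.deg 1 k) := by
    have := (isGradedMap_iff _ _ _).mp (F.graded 0) k F.base
    rwa [F.deg_base, sub_zero] at this
  have hf0 : f ≠ 0 := by
    intro h
    refine F.constantCoeff_ne_zero_of_D_eq (k := k) (w := 0) ?_ (by simp)
    rw [map_zero]
    ext1 l
    rw [F.eq_base l]
    exact h
  obtain ⟨m, hm⟩ := support_nonempty.mpr hf0
  have hfm : f = monomial m (coeff m f) := by
    ext m'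
    rw [coeff_monomial]
    split_ifs with h
    · rw [h]
    · by_contra hc
      refine h (Finsupp.ext fun v => ?_)
      have h1 := hfh m hm v
      have h2 := hfh m' (mem_support_iff.mpr hc) v
      omega
  have hfI : f ∈ I := (F.mem_range_zero _).mp ⟨_, rfl⟩
  have hfI' := hfI
  rw [hIS, monomialIdeal, mem_ideal_span_monomial_image] at hfI'
  obtain ⟨s, hs, hsm⟩ := hfI' m hm
  have hsI : monomial s (1 : K) ∈ I := hIS ▸ Ideal.subset_span ⟨s, hs, rfl⟩
  obtain ⟨w, hw⟩ := (F.mem_range_zero fun _ => monomial s 1).mpr hsI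
  have h1 : F.D 0 (Pi.single k 1) = F.D 0 (monomial (m - s) (coeff m f) • w) := by
    rw [map_smul, hw]
    ext1 l
    rw [F.eq_base l, ← hf, Pi.smul_apply, smul_eq_mul, monomial_mul, mul_one,
      tsub_add_cancel_of_le hsm]
    exact hfm
  have h2 := F.constantCoeff_ne_zero_of_D_eq h1
  have h3 : m - s = 0 := by
    by_contra hne
    refine h2 ?_
    rw [Pi.smul_apply, smul_eq_mul, map_mul, constantCoeff_monomial, if_neg hne, zero_mul]
  have h4 : m = s := le_antisymm (tsub_eq_zero_iff_le.mp h3) hsm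
  exact ⟨m, h4 ▸ hS s hs, fun v => (hfh m hm v).symm⟩

/-- The multidegrees in a minimal resolution of an ideal generated in degree `d` are bounded. -/
theorem Resolution.deg_le (F : Resolution I) {d : ℕ} (hI : IsMonomialGeneratedInDegree I d) :
    ∀ i k v, F.deg i k v ≤ d
  | 0, k, v => by
    rw [F.eq_base k, F.deg_base]
    simp
  | 1, k, v => by
    obtain ⟨m, hm, hk⟩ := F.exists_deg_one_eq hI k
    rw [hk, ← hm]
    exact_mod_cast Finsupp.le_degree v m
  | i + 2, k, v => by
    classical
    -- The degrees one position lower are at most `d` in coordinate `v`, so `x_v` divides the whole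
    -- column. The quotient is again a cycle, hence a boundary `D w`, and the basis vector has the
    -- same image as `x_v w`, against minimality.
    by_contra! hlt
    have hdvd : ∀ l, X v ∣ F.D (i + 1) (Pi.single k 1) l := by
      intro l
      refine X_dvd_of_part_eq _ _ ((isMultihomogeneous_iff _ _).mp
        ((isGradedMap_iff _ _ _).mp (F.graded (i + 1)) k l)) v ?_
      exact sub_pos.mpr ((F.deg_le hI (i + 1) l v).trans_lt hlt)
    choose z hz using hdvd
    have hz' : F.D (i + 1) (Pi.single k 1) = (X v : MvPolynomial (Fin n) K) • z := funext hz
    have h1 : F.D i z = 0 := by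
      have := F.D_D i (Pi.single k 1)
      rw [hz', map_smul] at this
      exact (smul_eq_zero.mp this).resolve_left (X_ne_zero v)
    obtain ⟨w, rfl⟩ := F.mem_range_succ h1
    rw [← map_smul] at hz'
    exact F.constantCoeff_ne_zero_of_D_eq hz' (by simp)

theorem Resolution.exists_of_bettiNumber_ne_zero (F : Resolution I) {i : ℕ} {j : ℤ}
    (h : bettiNumber I i j ≠ 0) : ∃ k : F.ι (i + 1), ∑ v, F.deg (i + 1) k v = j := by
  rw [F.bettiNumber_eq] at h
  obtain ⟨k, hk⟩ := (Nat.card_ne_zero.mp h).1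
  exact ⟨k, hk⟩

theorem bettiNumber_zero_ne_zero {d : ℕ} (hI : IsMonomialGeneratedInDegree I d) (h0 : I ≠ ⊥) :
    bettiNumber I 0 d ≠ 0 := by
  obtain ⟨F⟩ := MonomialBetti.exists_resolution I (part_mem_of_generated hI)
  have hne : Nonempty (F.ι 1) := by
    by_contra hempty
    rw [not_nonempty_iff] at hempty
    refine h0 ((Submodule.eq_bot_iff _).mpr fun f hf => ?_)
    obtain ⟨w, hw⟩ := (F.mem_range_zero fun _ => f).mpr hf
    rw [Subsingleton.elim w 0, map_zero] at hw
    exact (congrFun hw F.base).symm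
  obtain ⟨k⟩ := hne
  obtain ⟨m, hm, hk⟩ := F.exists_deg_one_eq hI k
  rw [F.bettiNumber_eq]
  refine Nat.card_ne_zero.mpr ⟨⟨⟨k, ?_⟩⟩, inferInstance⟩
  rw [← hm, cast_degree_eq_sum]
  exact Finset.sum_congr rfl fun v _ => hk v

/-- As `i ≥ 0` and each of the `n` coordinates is at most `d`, one has `j - i ≤ n d`; no bound on
the length of the resolution is needed. -/
theorem exists_isRegularity {d : ℕ} (hI : IsMonomialGeneratedInDegree I d) (h0 : I ≠ ⊥) :
    ∃ r, IsRegularity I r := by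
  obtain ⟨F⟩ := MonomialBetti.exists_resolution I (part_mem_of_generated hI)
  obtain ⟨r, hr, hmax⟩ := Int.exists_greatest_of_bdd
    (P := fun c => ∃ (i : ℕ) (j : ℤ), bettiNumber I i j ≠ 0 ∧ c = j - i)
    ⟨∑ _v : Fin n, (d : ℤ), by
      rintro _ ⟨i, j, hij, rfl⟩
      obtain ⟨k, rfl⟩ := F.exists_of_bettiNumber_ne_zero hij
      have := Finset.sum_le_sum fun v (_ : v ∈ Finset.univ) => F.deg_le hI (i + 1) k v
      omega⟩
    ⟨_, 0, d, bettiNumber_zero_ne_zero hI h0, rfl⟩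
  exact ⟨r, hr, fun c hc => hmax c hc⟩

theorem bettiNumber_bot (i : ℕ) (j : ℤ) :
    bettiNumber (⊥ : Ideal (MvPolynomial (Fin n) K)) i j = 0 := by
  rw [Resolution.bot.bettiNumber_eq]
  exact Nat.card_eq_zero.mpr (Or.inl ⟨fun k => Empty.elim k.1⟩)

end Regularity

end MonomialBetti

/-! ### The theorem. -/

theorem theorem3p9 {K : Type*} [Field K] {n : ℕ}
    (I : Ideal (MvPolynomial (Fin n) K)) (d : ℕ) (u : Fin n →₀ ℕ)
    (hu : MonomialBetti.IsStronglyLinear I d u) (A : Set (Fin n)) :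
    (∀ (s : ℕ) (t : ℤ), t - s ≠ d →
      MonomialBetti.bettiNumber
          (I + Ideal.span {MvPolynomial.monomial u (1 : K)} * MonomialBetti.variableIdeal K A) s t
        = MonomialBetti.bettiNumber I s t) ∧
    (I ≠ ⊥ → ∃ r : ℤ,
      MonomialBetti.IsRegularity
          (I + Ideal.span {MvPolynomial.monomial u (1 : K)} * MonomialBetti.variableIdeal K A) r ∧
        MonomialBetti.IsRegularity I r) ∧
    (MonomialBetti.HasLinearResolution I ↔
      MonomialBetti.HasLinearResolution
        (I + Ideal.span {MvPolynomial.monomial u (1 : K)} *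
          MonomialBetti.variableIdeal K A)) := by
  obtain ⟨F⟩ := MonomialBetti.exists_resolution I
    (MonomialBetti.part_mem_of_generated hu.generated)
  obtain ⟨H, hH⟩ := hu.exists_resolution F A
  generalize I + Ideal.span {MvPolynomial.monomial u (1 : K)} *
    MonomialBetti.variableIdeal K A = I' at H hH
  have heq : ∀ (s : ℕ) (t : ℤ), t - s ≠ d →
      MonomialBetti.bettiNumber I' s t = MonomialBetti.bettiNumber I s t := by
    intro s t hst
    rw [F.bettiNumber_eq, H.bettiNumber_eq, (hH s t).2 hst]
  -- Off `d` the Betti numbers agree; the value `d` itself occurs for both ideals, since `β_{0,d}(I)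
  -- ≠ 0` and the strand only grows.
  have hset : I ≠ ⊥ → ∀ c : ℤ,
      (∃ (i : ℕ) (j : ℤ), MonomialBetti.bettiNumber I' i j ≠ 0 ∧ c = j - i) ↔
      ∃ (i : ℕ) (j : ℤ), MonomialBetti.bettiNumber I i j ≠ 0 ∧ c = j - i := by
    intro h0 c
    have h1 := MonomialBetti.bettiNumber_zero_ne_zero hu.generated h0
    have h2 : MonomialBetti.bettiNumber I' 0 d ≠ 0 := by
      rw [F.bettiNumber_eq] at h1
      rw [H.bettiNumber_eq]
      exact ((Nat.pos_of_ne_zero h1).trans_le (hH 0 d).1).ne'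
    by_cases hc : c = d
    · exact iff_of_true ⟨0, d, h2, by simp [hc]⟩ ⟨0, d, h1, by simp [hc]⟩
    · refine exists_congr fun i => exists_congr fun j => and_congr_left ?_
      rintro rfl
      rw [heq i j hc]
  refine ⟨heq, fun h0 => ?_, ?_⟩
  · obtain ⟨r, hr⟩ := MonomialBetti.exists_isRegularity hu.generated h0
    refine ⟨r, ?_, hr⟩
    rw [MonomialBetti.IsRegularity, Set.ext (hset h0)]
    exact hr
  · by_cases h0 : I = ⊥
    · subst h0
      -- For `I = 0` any constant serves for `I`, while the Betti numbers of `I'` are confined to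
      -- the strand `d`.
      refine iff_of_true ⟨0, fun i j _ => MonomialBetti.bettiNumber_bot i j⟩ ⟨d, fun i j hij => ?_⟩
      rw [heq i j hij, MonomialBetti.bettiNumber_bot]
    · refine exists_congr fun c => ?_
      -- Linearity with constant `c` depends only on the set of values `j - i`, to which `hset`
      -- applies.
      have hlin : ∀ L : Ideal (MvPolynomial (Fin n) K),
          (∀ (i : ℕ) (j : ℤ), j - i ≠ c → MonomialBetti.bettiNumber L i j = 0) ↔
          ∀ c', (∃ (i : ℕ) (j : ℤ), MonomialBetti.bettiNumber L i j ≠ 0 ∧ c' = j - i) →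
            c' = c := by
        intro L
        constructor
        · rintro h _ ⟨i, j, hij, rfl⟩
          exact not_imp_comm.mp (h i j) hij
        · intro h i j hij
          by_contra hne
          exact hij (h _ ⟨i, j, hne, rfl⟩)
      rw [hlin, hlin]
      simp only [hset h0]
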